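/- Let $n\ge 2$ and let indices $i$ be cyclic modulo $n$, with $i\oplus1$, $i\ominus1$ the next and the previous index. A cyclic system of rank $n$ consists, for each context $i=1,\dots,n$, of a jointly distributed pair $(A_i^i,A_{i\oplus1}^i)$ of $\pm1$-valued random variables; different contexts have no joint distribution. Put $e_j^i=\langle A_j^i\rangle$ ($j=i,i\oplus1$) and $e_{i,i\oplus1}=\langle A_i^iA_{i\oplus1}^i\rangle$. The system is noncontextual if all $2n$ variables have a joint distribution (a coupling) that reproduces the distribution of the pair in each context and in which, for every $i$, the probability that $A_i^i$ and $A_i^{i\ominus1}$ both equal $1$ is maximal, i.e. equals $\min(\Pr[A_i^i=1],\Pr[A_i^{i\ominus1}=1])$. Otherwise it is contextual. Fix the expectations $e_i^i,e_{i\oplus1}^i\in(-1,1)$ (no variable is deterministic), and let $$\Delta=\min\Big(n-2+\sum_{i=1}^n|e_i^i-e_i^{i\ominus1}|,\;n\Big),\qquad \mathbb R_{\mathbf b}=\prod_{i=1}^n\big[\,|e_i^i+e_{i\oplus1}^i|-1,\;1-|e_i^i-e_{i\oplus1}^i|\,\big].$$ A vertex $V$ of the box $\mathbb R_{\mathbf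 b}$ is odd if an odd number of its coordinates are min-coordinates; let $\lambda_i=-1$ if the $i$-th coordinate of $V$ is a min-coordinate and $\lambda_i=1$ otherwise. The hyperplane $\sum_i\lambda_i x_i=\Delta$ is pocket-forming at $V$ if it meets each of the $n$ edges of $\mathbb R_{\mathbf b}$ emanating from $V$ in a point other than $V$ (possibly the other end of the edge). In that case the set of all $x\in\mathbb R_{\mathbf b}$ with $\sum_i\lambda_ix_i>\Delta$ is called the pocket at $V$, and it is regular if the hyperplane cuts all $n$ edges emanating from $V$ at the same distance from $V$. Then a point $x\in\mathbb R^n$ represents a contextual system (that is, there is a contextual cyclic system with the given single-variable expectations and with $(e_{i,i\oplus1})_{i=1}^n=x$) if and only if $x$ belongs to the pocket at some odd vertex $V$ of $\mathbb R_{\mathbf b}$ at which the hyperplane $\sum_i\lambda_ix_i=\Delta$ is pocket-forming. All these pockets are regular, and their number $k$ satisfies $0\le k\le 2^{n-1}$. -/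

import Mathlib

/-! ### Cyclic systems of binary random variables

Contexts and contents are both indexed by the cyclic group `Fin n`.  Context `i` holds the jointly
distributed Bernoulli pair `(R_i^i, R_{i⊕1}^i)`; an outcome of this pair is an element of
`Bool × Bool`, with `true` for the value `1`.  Addition and subtraction on `Fin n` are modulo `n`. -/

/-- Probability of the event `E` under the distribution with weights `h` on a finite set. -/
def prob {Ω : Type*} [Fintype Ω] (h : Ω → ℝ) (E : Ω → Prop) [DecidablePred E] : ℝ :=
  ∑ ω with E ω, h ω

/-- A cyclic system of rank `n`: for each context `i`, the joint distribution of the bunch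
`(R_i^i, R_{i⊕1}^i)`.  Different contexts have no joint distribution. -/
structure CyclicSystem (n : ℕ) where
  bunch : Fin n → Bool × Bool → ℝ
  bunch_mem : ∀ i, bunch i ∈ stdSimplex ℝ (Bool × Bool)

namespace CyclicSystem

variable {n : ℕ}

/-- `p_i^i = Pr[R_i^i = 1]`. -/
def pOwn (R : CyclicSystem n) (i : Fin n) : ℝ := prob (R.bunch i) fun r => r.1 = true

/-- `p_{i⊕1}^i = Pr[R_{i⊕1}^i = 1]`. -/
def pNext (R : CyclicSystem n) (i : Fin n) : ℝ := prob (R.bunch i) fun r => r.2 = true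

/-- `p_{i,i⊕1} = Pr[R_i^i = R_{i⊕1}^i = 1]`. -/
def pBoth (R : CyclicSystem n) (i : Fin n) : ℝ :=
  prob (R.bunch i) fun r => r.1 = true ∧ r.2 = true

/-- `e_i^i`, the expectation of `A_i^i = 2 R_i^i - 1`. -/
def eOwn (R : CyclicSystem n) (i : Fin n) : ℝ := 2 * R.pOwn i - 1

/-- `e_{i⊕1}^i`, the expectation of `A_{i⊕1}^i = 2 R_{i⊕1}^i - 1`. -/
def eNext (R : CyclicSystem n) (i : Fin n) : ℝ := 2 * R.pNext i - 1

/-- `e_{i,i⊕1}`, the expectation of the product `A_i^i A_{i⊕1}^i`. -/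
def eBunch (R : CyclicSystem n) (i : Fin n) : ℝ :=
  4 * R.pBoth i - 2 * R.pOwn i - 2 * R.pNext i + 1

/-- `h` is (the law of) an overall coupling of `R`: a joint distribution of all `2n` variables
`S_i^i, S_{i⊕1}^i` (an outcome `r` gives to context `i` the pair `r i` of values) that has the same
single and bunch product expectations as `R`. -/
def IsCoupling (R : CyclicSystem n) (h : (Fin n → Bool × Bool) → ℝ) : Prop :=
  h ∈ stdSimplex ℝ (Fin n → Bool × Bool) ∧
  ∀ i, prob h (fun r => (r i).1 = true) = R.pOwn i ∧
    prob h (fun r => (r i).2 = true) = R.pNext i ∧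
    prob h (fun r => (r i).1 = true ∧ (r i).2 = true) = R.pBoth i

/-- `R` is noncontextual if it has a coupling under which each connection
`(S_i^i, S_i^{i⊖1})` is maximally coupled, i.e. `Pr[S_i^i = S_i^{i⊖1} = 1]` has its largest
possible value `min (p_i^i, p_i^{i⊖1})`. -/
def IsNoncontextual [NeZero n] (R : CyclicSystem n) : Prop :=
  ∃ h, R.IsCoupling h ∧
    ∀ i, prob h (fun r => (r i).1 = true ∧ (r (i - 1)).2 = true) =
      min (R.pOwn i) (R.pNext (i - 1))

end CyclicSystem

/-- For fixed single-variable expectations `a i = e_i^i`, `b i = e_{i⊕1}^i`: the point `x` (a vector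
of bunch product expectations) represents a contextual system. -/
def RepresentsContextual {n : ℕ} [NeZero n] (a b x : Fin n → ℝ) : Prop :=
  ∃ R : CyclicSystem n, R.eOwn = a ∧ R.eNext = b ∧ R.eBunch = x ∧ ¬ R.IsNoncontextual

/-- `Δ = min (n - 2 + δ, n)`, where `δ = ∑ |e_i^i - e_i^{i⊖1}|`. -/
noncomputable def Delta {n : ℕ} [NeZero n] (a b : Fin n → ℝ) : ℝ :=
  min ((n : ℝ) - 2 + ∑ i, |a i - b (i - 1)|) n

/-- The min-coordinates of the box `R_b`. -/
def boxMin {n : ℕ} (a b : Fin n → ℝ) (i : Fin n) : ℝ := |a i + b i| - 1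

/-- The max-coordinates of the box `R_b`. -/
def boxMax {n : ℕ} (a b : Fin n → ℝ) (i : Fin n) : ℝ := 1 - |a i - b i|

/-! ### Boxes, odd vertices and pockets

The box with min-coordinates `lo` and max-coordinates `hi` is `Set.Icc lo hi`. -/

/-- `V` is an odd vertex of the box: each coordinate is a min- or a max-coordinate, and an odd
number of them are min-coordinates. -/
def IsOddVertex {n : ℕ} (lo hi V : Fin n → ℝ) : Prop :=
  (∀ i, V i = lo i ∨ V i = hi i) ∧ Odd {i | V i = lo i}.ncard

/-- The signs `λ_i` of a vertex `V`: `-1` at min-coordinates and `1` at max-coordinates. -/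
noncomputable def vertexSign {n : ℕ} (lo V : Fin n → ℝ) (i : Fin n) : ℝ :=
  if V i = lo i then -1 else 1

/-- The edge of the box that emanates from the vertex `V` in direction `i`: the segment from `V` to
the vertex whose `i`-th coordinate `lo i + hi i - V i` is the other endpoint of
`[lo i, hi i]`. -/
def boxEdge {n : ℕ} (lo hi V : Fin n → ℝ) (i : Fin n) : Set (Fin n → ℝ) :=
  segment ℝ V (Function.update V i (lo i + hi i - V i))

/-- The hyperplane `∑ c_i x_i = d`. -/
def hyperplane {n : ℕ} (c : Fin n → ℝ) (d : ℝ) : Set (Fin n → ℝ) :=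
  {x | ∑ i, c i * x i = d}

/-- The hyperplane `H` is pocket-forming at the vertex `V` of the box: it cuts every edge emanating
from `V` beyond `V` (possibly at the other end of the edge). -/
def IsPocketForming {n : ℕ} (lo hi V : Fin n → ℝ) (H : Set (Fin n → ℝ)) : Prop :=
  ∀ i, ∃ y ∈ boxEdge lo hi V i, y ∈ H ∧ y ≠ V

/-- The pocket-forming hyperplane `H` forms a regular pocket at `V`: it cuts all the edges emanating
from `V` at one and the same distance from `V`.  (A point of an edge differs from `V` in one
coordinate only, so the distance does not depend on the choice of the norm.) -/
def IsRegularAt {n : ℕ} (lo hi V : Fin n → ℝ) (H : Set (Fin n → ℝ)) : Prop :=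
  IsPocketForming lo hi V H ∧ ∃ t : ℝ, ∀ i, ∀ y ∈ boxEdge lo hi V i, y ∈ H → dist V y = t

/-- The region of the box strictly above the hyperplane `∑ c_i x_i = d`. -/
def pocket {n : ℕ} (lo hi c : Fin n → ℝ) (d : ℝ) : Set (Fin n → ℝ) :=
  {x | x ∈ Set.Icc lo hi ∧ d < ∑ i, c i * x i}

/-- `V` is an odd vertex of the box at which the hyperplane `∑ λ_i x_i = d` is pocket-forming, where
`λ` are the signs of `V`. -/
def IsPocketVertex {n : ℕ} (lo hi : Fin n → ℝ) (d : ℝ) (V : Fin n → ℝ) : Prop :=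
  IsOddVertex lo hi V ∧ IsPocketForming lo hi V (hyperplane (vertexSign lo V) d)

/-- The set of all pockets formed at the odd vertices `V` of the box by the hyperplanes
`∑ λ_i x_i = d`. -/
def pockets {n : ℕ} (lo hi : Fin n → ℝ) (d : ℝ) : Set (Set (Fin n → ℝ)) :=
  {P | ∃ V, IsPocketVertex lo hi d V ∧ P = pocket lo hi (vertexSign lo V) d}

/-! The proof has two halves. The first is a criterion: with δ = ∑ |e_i^i - e_i^{i⊖1}|, a cyclic
system is noncontextual iff ∑ λ_i x_i ≤ n - 2 + δ for all signs with ∏ λ_i = -1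
(`CyclicSystem.isNoncontextual_iff`). A maximal connection has product expectation 1 - |e_i^i -
e_i^{i⊖1}|, so noncontextuality asks for 2n signs with given means and given consecutive product
expectations around a cycle. Necessity is parity: 2n signs with product -1 sum to at most 2n - 2
(`sum_signs_le`). For sufficiency the cycle is opened into a path built one variable at a time by
conditionally independent gluing. The attainable correlations of its ends include all those in an
interval [1 - α, β - 1] compatible with the two end means, where α and β behave like cheapest costs
of even and odd sign patterns (`PathReach.succ`). The odd inequalities say that the correlation
closing the cycle lies in that interval.

The second half is geometry. A move by t along an edge from V lowers ∑ λ_i x_i by t, so all cuts are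
at the same distance, the excess of V over Δ. If an odd inequality fails in the box, this excess is
positive and at most every edge length. For the first term of Δ, this is a triangle inequality
around the cycle (`abs_add_abs_le_of_odd`); for the term n it is immediate. -/

/-- The value `±1` of a binary outcome. -/
def boolSign (s : Bool) : ℝ := if s then 1 else -1

@[simp] theorem boolSign_true : boolSign true = 1 := rfl

@[simp] theorem boolSign_false : boolSign false = -1 := rfl

theorem boolSign_eq (s : Bool) : boolSign s = 1 ∨ boolSign s = -1 := by cases s <;> simp

theorem boolSign_mul_self (s : Bool) : boolSign s * boolSign s = 1 := by cases s <;> simp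

/-! ### Laws of two and three signs, and gluing -/

/-- The conditions on the means `a`, `b` and the product expectation `e` under which a pair of
`±1`-valued random variables with these expectations exists. -/
def IsPairMoments (a b e : ℝ) : Prop := |a + b| - 1 ≤ e ∧ e ≤ 1 - |a - b|

theorem isPairMoments_iff (a b e : ℝ) :
    IsPairMoments a b e ↔ 0 ≤ 1 + a + b + e ∧ 0 ≤ 1 - a - b + e ∧ 0 ≤ 1 + a - b - e ∧
      0 ≤ 1 - a + b - e := by
  unfold IsPairMoments
  constructor
  · rintro ⟨h1, h2⟩
    have := neg_abs_le (a + b)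
    have := le_abs_self (a + b)
    have := neg_abs_le (a - b)
    have := le_abs_self (a - b)
    refine ⟨?_, ?_, ?_, ?_⟩ <;> linarith
  · rintro ⟨h1, h2, h3, h4⟩
    have h5 : |a + b| ≤ 1 + e := abs_le.2 ⟨by linarith, by linarith⟩
    have h6 : |a - b| ≤ 1 - e := abs_le.2 ⟨by linarith, by linarith⟩
    constructor <;> linarith

theorem exists_between_four {l₁ l₂ l₃ l₄ u₁ u₂ u₃ u₄ : ℝ}
    (h₁ : l₁ ≤ u₁ ∧ l₁ ≤ u₂ ∧ l₁ ≤ u₃ ∧ l₁ ≤ u₄) (h₂ : l₂ ≤ u₁ ∧ l₂ ≤ u₂ ∧ l₂ ≤ u₃ ∧ l₂ ≤ u₄)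
    (h₃ : l₃ ≤ u₁ ∧ l₃ ≤ u₂ ∧ l₃ ≤ u₃ ∧ l₃ ≤ u₄) (h₄ : l₄ ≤ u₁ ∧ l₄ ≤ u₂ ∧ l₄ ≤ u₃ ∧ l₄ ≤ u₄) :
    ∃ t, (l₁ ≤ t ∧ l₂ ≤ t ∧ l₃ ≤ t ∧ l₄ ≤ t) ∧ t ≤ u₁ ∧ t ≤ u₂ ∧ t ≤ u₃ ∧ t ≤ u₄ := by
  refine ⟨max (max l₁ l₂) (max l₃ l₄), ⟨by simp, by simp, by simp, by simp⟩, ?_⟩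
  simp only [max_le_iff]
  tauto

/-- Three `±1`-valued random variables with prescribed means and product expectations exist if each
pair exists and the four triangle inequalities hold. -/
theorem exists_triple_law {a b c z e y : ℝ} (hz : IsPairMoments a b z) (he : IsPairMoments b c e)
    (hy : IsPairMoments a c y) (h₁ : |e + y| - 1 ≤ z) (h₂ : z ≤ 1 - |e - y|) :
    ∃ T : Bool → Bool → Bool → ℝ, (∀ s t r, 0 ≤ T s t r) ∧
      (∀ s t, ∑ r, T s t r =
        (1 + boolSign s * a + boolSign t * b + boolSign s * boolSign t * z) / 4) ∧
      ∑ s, ∑ t, ∑ r, T s t r * boolSign r = c ∧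
      ∑ s, ∑ t, ∑ r, T s t r * (boolSign t * boolSign r) = e ∧
      ∑ s, ∑ t, ∑ r, T s t r * (boolSign s * boolSign r) = y := by
  have hp : IsPairMoments e y z := ⟨h₁, h₂⟩
  rw [isPairMoments_iff] at hz he hy hp
  obtain ⟨z1, z2, z3, z4⟩ := hz
  obtain ⟨e1, e2, e3, e4⟩ := he
  obtain ⟨y1, y2, y3, y4⟩ := hy
  obtain ⟨p1, p2, p3, p4⟩ := hp
  -- The free parameter t is the expectation of the triple product. Nonnegativity of the eight atoms
  -- gives four lower and four upper bounds on it; the sixteen comparisons are exactly the twelve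
  -- pair inequalities and the four triangle inequalities.
  obtain ⟨t, ⟨l1, l2, l3, l4⟩, u1, u2, u3, u4⟩ := exists_between_four
    (l₁ := -(1 + a + b + c + z + e + y)) (l₂ := -(1 + a - b - c - z + e - y))
    (l₃ := -(1 - a + b - c - z - e + y)) (l₄ := -(1 - a - b + c + z - e - y))
    (u₁ := 1 - a - b - c + z + e + y) (u₂ := 1 - a + b + c - z + e - y)
    (u₃ := 1 + a - b + c - z - e + y) (u₄ := 1 + a + b - c + z - e - y)
    ⟨by linarith, by linarith, by linarith, by linarith⟩
    ⟨by linarith, by linarith, by linarith, by linarith⟩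
    ⟨by linarith, by linarith, by linarith, by linarith⟩
    ⟨by linarith, by linarith, by linarith, by linarith⟩
  refine ⟨fun s t' r => (1 + boolSign s * a + boolSign t' * b + boolSign r * c +
    boolSign s * boolSign t' * z + boolSign t' * boolSign r * e + boolSign s * boolSign r * y +
    boolSign s * boolSign t' * boolSign r * t) / 8, ?_, ?_, ?_, ?_, ?_⟩
  · intro s t' r
    cases s <;> cases t' <;> cases r <;> simp <;> linarith
  · intro s t'
    simp
    ring
  all_goals
    simp
    ring

/-- A random variable `b` is added to a finite probability space so that its joint law with two
given variables `X`, `Y` is a prescribed law `T` that is compatible with the law of `(X, Y)`. -/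
theorem exists_glue {Ω : Type} [Fintype Ω] (h : Ω → ℝ) (h0 : ∀ ω, 0 ≤ h ω) (X Y : Ω → Bool)
    (T : Bool → Bool → Bool → ℝ) (hT : ∀ s t r, 0 ≤ T s t r)
    (hm : ∀ s t, ∑ r, T s t r = ∑ ω, if X ω = s ∧ Y ω = t then h ω else 0) :
    ∃ g : Ω × Bool → ℝ, (∀ ω, 0 ≤ g ω) ∧
      (∀ f : Ω → ℝ, ∑ ω, g ω * f ω.1 = ∑ ω, h ω * f ω) ∧
      ∀ f : Bool → Bool → Bool → ℝ, ∑ ω, g ω * f (X ω.1) (Y ω.1) ω.2 =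
        ∑ s, ∑ t, ∑ r, T s t r * f s t r := by
  set P : Bool → Bool → ℝ := fun s t => ∑ r, T s t r with hP
  have hP0 : ∀ s t, 0 ≤ P s t := fun s t => Finset.sum_nonneg fun r _ => hT s t r
  -- The new variable is drawn from its conditional law under `T` given (X, Y). Where `P` vanishes
  -- so does `h`, and the value of division by zero is harmless.
  refine ⟨fun ω => h ω.1 * (T (X ω.1) (Y ω.1) ω.2 / P (X ω.1) (Y ω.1)), ?_, ?_, ?_⟩
  · exact fun ω => mul_nonneg (h0 _) (div_nonneg (hT _ _ _) (hP0 _ _))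
  · intro f
    rw [Fintype.sum_prod_type]
    refine Finset.sum_congr rfl fun ω _ => ?_
    dsimp only
    rw [← Finset.sum_mul, ← Finset.mul_sum, ← Finset.sum_div]
    by_cases hp : P (X ω) (Y ω) = 0
    · have h1 : h ω ≤ P (X ω) (Y ω) := by
        simp only [hP, hm]
        refine le_trans (by simp) (Finset.single_le_sum
          (f := fun ω' => if X ω' = X ω ∧ Y ω' = Y ω then h ω' else 0) (fun ω' _ => ?_)
          (Finset.mem_univ ω))
        split_ifs
        exacts [h0 _, le_rfl]
      have h2 : h ω = 0 := le_antisymm (h1.trans hp.le) (h0 ω)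
      simp [h2]
    · have : (∑ r, T (X ω) (Y ω) r) / P (X ω) (Y ω) = 1 := div_self hp
      rw [this, mul_one]
  · intro f
    have key : ∀ s t r, T s t r = (∑ ω, if X ω = s ∧ Y ω = t then h ω else 0) *
        (T s t r / P s t) := by
      intro s t r
      rw [← hm]
      change T s t r = P s t * (T s t r / P s t)
      by_cases hp : P s t = 0
      · have : T s t r ≤ P s t :=
          Finset.single_le_sum (fun r _ => hT s t r) (Finset.mem_univ r)
        rw [hp, zero_mul]
        exact le_antisymm (this.trans hp.le) (hT _ _ _)
      · field_simp
    have e1 : ∑ s, ∑ t, ∑ r, T s t r * f s t r = ∑ s, ∑ t, ∑ r, ∑ ω,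
        if X ω = s ∧ Y ω = t then h ω * (T s t r / P s t) * f s t r else 0 := by
      refine Finset.sum_congr rfl fun s _ => Finset.sum_congr rfl fun t _ =>
        Finset.sum_congr rfl fun r _ => ?_
      nth_rewrite 1 [key s t r]
      rw [Finset.sum_mul, Finset.sum_mul]
      refine Finset.sum_congr rfl fun ω _ => ?_
      split_ifs <;> simp
    rw [e1, Fintype.sum_prod_type]
    simp only [Fintype.sum_bool, ← Finset.sum_add_distrib]
    refine Finset.sum_congr rfl fun ω _ => ?_
    cases X ω <;> cases Y ω <;> simp

/-! ### Attainable end correlations of a path -/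

/-- There are `±1`-valued random variables indexed by `0, …, k` on a finite probability space, with
means `c`, product expectations `e` of consecutive variables, and product expectation `y` of the
first and the last variable. -/
def PathCouples (c e : ℕ → ℝ) (k : ℕ) (y : ℝ) : Prop :=
  ∃ (Ω : Type) (_ : Fintype Ω) (h : Ω → ℝ) (W : ℕ → Ω → Bool), (∀ ω, 0 ≤ h ω) ∧ ∑ ω, h ω = 1 ∧
    (∀ j ≤ k, ∑ ω, h ω * boolSign (W j ω) = c j) ∧
    (∀ j < k, ∑ ω, h ω * (boolSign (W j ω) * boolSign (W (j + 1) ω)) = e j) ∧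
    ∑ ω, h ω * (boolSign (W 0 ω) * boolSign (W k ω)) = y

theorem pathCouples_zero (c e : ℕ → ℝ) (hc : |c 0| ≤ 1) : PathCouples c e 0 1 := by
  rw [abs_le] at hc
  refine ⟨Bool, inferInstance, fun s => (1 + boolSign s * c 0) / 2, fun _ s => s, ?_, ?_, ?_, ?_, ?_⟩
  · intro s
    cases s <;> simp <;> linarith
  · simp
    ring
  · intro j hj
    obtain rfl : j = 0 := by omega
    simp
    ring
  · intro j hj
    omega
  · simp
    ring

theorem sum_ite_eq_moments {Ω : Type} [Fintype Ω] (h : Ω → ℝ) (X Y : Ω → Bool) (s t : Bool) :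
    (∑ ω, if X ω = s ∧ Y ω = t then h ω else 0) =
      (∑ ω, h ω + boolSign s * ∑ ω, h ω * boolSign (X ω) +
        boolSign t * ∑ ω, h ω * boolSign (Y ω) +
        boolSign s * boolSign t * ∑ ω, h ω * (boolSign (X ω) * boolSign (Y ω))) / 4 := by
  rw [Finset.mul_sum, Finset.mul_sum, Finset.mul_sum, ← Finset.sum_add_distrib,
    ← Finset.sum_add_distrib, ← Finset.sum_add_distrib, Finset.sum_div]
  refine Finset.sum_congr rfl fun ω _ => ?_
  cases X ω <;> cases Y ω <;> cases s <;> cases t <;> simp <;> ring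

/-- Only the joint law of the two ends matters for the extension: the new variable is attached to
the pair (first, last) through a three-variable law, and the inner variables keep their joint law
with that pair. -/
theorem PathCouples.succ {c e : ℕ → ℝ} {k : ℕ} {z y : ℝ} (hk : PathCouples c e k z)
    (hz : IsPairMoments (c 0) (c k) z) (he : IsPairMoments (c k) (c (k + 1)) (e k))
    (hy : IsPairMoments (c 0) (c (k + 1)) y) (h₁ : |e k + y| - 1 ≤ z) (h₂ : z ≤ 1 - |e k - y|) :
    PathCouples c e (k + 1) y := by
  obtain ⟨T, T0, Tm, Tc, Te, Ty⟩ := exists_triple_law hz he hy h₁ h₂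
  obtain ⟨Ω, _, h, W, h0, hs, hc, hee, hzz⟩ := hk
  obtain ⟨g, g0, g1, g2⟩ := exists_glue h h0 (W 0) (W k) T T0 (fun s t => by
    rw [Tm, sum_ite_eq_moments, hs, hc 0 (Nat.zero_le _), hc k le_rfl, hzz])
  refine ⟨Ω × Bool, inferInstance, g, fun j ω => if j ≤ k then W j ω.1 else ω.2, g0, ?_, ?_, ?_, ?_⟩
  · simpa [hs] using g1 fun _ => 1
  · intro j hj
    rcases Nat.lt_or_ge k j with hkj | hkj
    · obtain rfl : j = k + 1 := by omega
      simp only [show ¬ k + 1 ≤ k by omega, if_false]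
      rw [← Tc]
      exact g2 fun _ _ r => boolSign r
    · simp only [hkj, if_true]
      rw [← hc j hkj]
      exact g1 fun ω => boolSign (W j ω)
  · intro j hj
    rcases Nat.lt_or_ge j k with hkj | hkj
    · simp only [hkj.le, Nat.succ_le_of_lt hkj, if_true]
      rw [← hee j hkj]
      exact g1 fun ω => boolSign (W j ω) * boolSign (W (j + 1) ω)
    · obtain rfl : j = k := by omega
      simp only [le_refl, if_true, show ¬ j + 1 ≤ j by omega, if_false]
      rw [← Te]
      exact g2 fun _ t r => boolSign t * boolSign r
  · simp only [Nat.zero_le, if_true, show ¬ k + 1 ≤ k by omega, if_false]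
    rw [← Ty]
    exact g2 fun s _ r => boolSign s * boolSign r

/-- The product expectations `y` of the ends of a path that are between `1 - α` and `β - 1` and
compatible with the means of the ends can be realized. -/
structure PathReach (c e : ℕ → ℝ) (k : ℕ) (α β : ℝ) : Prop where
  sub_bound : |c 0 - c k| ≤ α
  add_bound : |c 0 + c k| ≤ β
  two_le : 2 ≤ α + β
  couples : ∀ y, IsPairMoments (c 0) (c k) y → 1 - α ≤ y → y ≤ β - 1 → PathCouples c e k y

theorem pathReach_zero (c e : ℕ → ℝ) (hc : |c 0| ≤ 1) : PathReach c e 0 0 2 where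
  sub_bound := by simp
  add_bound := by
    rw [abs_le] at hc ⊢
    constructor <;> linarith
  two_le := by norm_num
  couples y _ h₁ h₂ := by
    obtain rfl : y = 1 := by linarith
    exact pathCouples_zero c e hc

/-- Fourier–Motzkin elimination of the old end correlation z. The conditions |e - y| ≤ α and |e + y|
≤ β left by the elimination bound y on each side twice, hence the two minima. -/
theorem PathReach.succ {c e : ℕ → ℝ} {k : ℕ} {α β : ℝ} (h : PathReach c e k α β)
    (he : IsPairMoments (c k) (c (k + 1)) (e k)) :
    PathReach c e (k + 1) (min (α + (1 - e k)) (β + (1 + e k)))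
      (min (α + (1 + e k)) (β + (1 - e k))) := by
  obtain ⟨ha, hb, hab, hc⟩ := h
  have he' := (isPairMoments_iff _ _ _).1 he
  obtain ⟨e1, e2, e3, e4⟩ := he'
  rw [abs_le] at ha hb
  obtain ⟨a1, a2⟩ := ha
  obtain ⟨b1, b2⟩ := hb
  refine ⟨?_, ?_, ?_, ?_⟩
  · rw [abs_le, neg_le, le_min_iff, le_min_iff]
    refine ⟨⟨?_, ?_⟩, ?_, ?_⟩ <;> linarith
  · rw [abs_le, neg_le, le_min_iff, le_min_iff]
    refine ⟨⟨?_, ?_⟩, ?_, ?_⟩ <;> linarith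
  · rcases min_choice (α + (1 - e k)) (β + (1 + e k)) with h1 | h1 <;>
      rcases min_choice (α + (1 + e k)) (β + (1 - e k)) with h2 | h2 <;>
      rw [h1, h2] <;> linarith
  · intro y hy hl hu
    have hy' := (isPairMoments_iff _ _ _).1 hy
    obtain ⟨y1, y2, y3, y4⟩ := hy'
    rw [sub_le_comm, le_min_iff] at hl
    rw [le_sub_iff_add_le, le_min_iff] at hu
    obtain ⟨l1, l2⟩ := hl
    obtain ⟨u1, u2⟩ := hu
    have i1 : |c 0 - c k| ≤ α := abs_le.2 ⟨by linarith, by linarith⟩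
    have i2 : |c 0 + c k| ≤ β := abs_le.2 ⟨by linarith, by linarith⟩
    have i3 : |e k - y| ≤ α := abs_le.2 ⟨by linarith, by linarith⟩
    have i4 : |e k + y| ≤ β := abs_le.2 ⟨by linarith, by linarith⟩
    have i5 : |c 0 + c k| + |e k - y| ≤ 2 := by
      rcases abs_choice (c 0 + c k) with h1 | h1 <;> rcases abs_choice (e k - y) with h2 | h2 <;>
        rw [h1, h2] <;> linarith
    have i6 : |c 0 - c k| + |e k + y| ≤ 2 := by
      rcases abs_choice (c 0 - c k) with h1 | h1 <;> rcases abs_choice (e k + y) with h2 | h2 <;>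
        rw [h1, h2] <;> linarith
    have i7 : |c 0 + c k| + |c 0 - c k| ≤ 2 := by
      rcases abs_choice (c 0 + c k) with h1 | h1 <;> rcases abs_choice (c 0 - c k) with h2 | h2 <;>
        rw [h1, h2] <;> linarith
    have i8 : |e k + y| + |e k - y| ≤ 2 := by
      rcases abs_choice (e k + y) with h1 | h1 <;> rcases abs_choice (e k - y) with h2 | h2 <;>
        rw [h1, h2] <;> linarith
    -- Three lower and three upper bounds on z: the reach of the path, the means, and the triangle
    -- inequalities. The fourth of each kind is padding.
    obtain ⟨z, ⟨z1, z2, z3, -⟩, z4, z5, z6, -⟩ := exists_between_four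
      (l₁ := 1 - α) (l₂ := |c 0 + c k| - 1) (l₃ := |e k + y| - 1) (l₄ := 1 - α)
      (u₁ := β - 1) (u₂ := 1 - |c 0 - c k|) (u₃ := 1 - |e k - y|) (u₄ := β - 1)
      ⟨by linarith, by linarith, by linarith, by linarith⟩
      ⟨by linarith, by linarith, by linarith, by linarith⟩
      ⟨by linarith, by linarith, by linarith, by linarith⟩
      ⟨by linarith, by linarith, by linarith, by linarith⟩
    exact (hc z ⟨z2, z5⟩ z1 z4).succ ⟨z2, z5⟩ he hy z3 z6

theorem isPairMoments_max {a b : ℝ} (ha : |a| ≤ 1) (hb : |b| ≤ 1) :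
    IsPairMoments a b (1 - |a - b|) := by
  refine ⟨?_, le_rfl⟩
  rw [abs_le] at ha hb
  rcases abs_choice (a + b) with h1 | h1 <;> rcases abs_choice (a - b) with h2 | h2 <;>
    rw [h1, h2] <;> linarith

/-- For a maximally coupled step, the other term of each minimum is implied by the compatibility of
y with the end means, by the triangle inequality. Connections therefore add their cost to both
bounds and contribute no choice of sign. -/
theorem PathReach.succ_max {c e : ℕ → ℝ} {k : ℕ} {α β : ℝ} (h : PathReach c e k α β)
    (hk : |c k| ≤ 1) (hk' : |c (k + 1)| ≤ 1) (he : e k = 1 - |c k - c (k + 1)|) :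
    PathReach c e (k + 1) (α + |c k - c (k + 1)|) (β + |c k - c (k + 1)|) := by
  have hs := h.succ (he ▸ isPairMoments_max hk hk')
  have ha := h.sub_bound
  have hb := h.add_bound
  have hab := h.two_le
  have t1 : |c 0 - c (k + 1)| ≤ |c 0 - c k| + |c k - c (k + 1)| := abs_sub_le _ _ _
  have t2 : |c k - c (k + 1)| ≤ |c 0 - c k| + |c 0 - c (k + 1)| := by
    rw [abs_sub_comm (c 0) (c k)]
    exact abs_sub_le _ _ _
  have t3 : |c 0 + c (k + 1)| ≤ |c 0 + c k| + |c k - c (k + 1)| := by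
    rw [show c 0 + c (k + 1) = (c 0 + c k) - (c k - c (k + 1)) by ring]
    exact abs_sub _ _
  have t4 : |c k - c (k + 1)| ≤ |c 0 + c k| + |c 0 + c (k + 1)| := by
    rw [show c k - c (k + 1) = (c 0 + c k) - (c 0 + c (k + 1)) by ring]
    exact abs_sub _ _
  have t5 := abs_nonneg (c k - c (k + 1))
  refine ⟨by linarith, by linarith, by linarith, fun y hy h1 h2 => hs.couples y hy ?_ ?_⟩
  · have := hy.1
    rw [sub_le_comm, le_min_iff, he]
    constructor <;> linarith
  · have := hy.2
    rw [le_sub_iff_add_le, le_min_iff, he]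
    constructor <;> linarith

/-! ### Sign patterns and closing the cycle -/

/-- The sequence `f 0, g 0, f 1, g 1, …` with indices modulo `n`. -/
def interleave {n : ℕ} [NeZero n] (f g : Fin n → ℝ) (j : ℕ) : ℝ :=
  if j % 2 = 0 then f (Fin.ofNat n (j / 2)) else g (Fin.ofNat n (j / 2))

theorem interleave_even {n : ℕ} [NeZero n] (f g : Fin n → ℝ) (i : ℕ) :
    interleave f g (2 * i) = f (Fin.ofNat n i) := by
  simp [interleave]

theorem interleave_odd {n : ℕ} [NeZero n] (f g : Fin n → ℝ) (i : ℕ) :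
    interleave f g (2 * i + 1) = g (Fin.ofNat n i) := by
  have h1 : (2 * i + 1) % 2 = 1 := by omega
  have h2 : (2 * i + 1) / 2 = i := by omega
  simp [interleave, h1, h2]

theorem ofNat_add_one {n : ℕ} [NeZero n] (i : ℕ) :
    Fin.ofNat n i + 1 = Fin.ofNat n (i + 1) := by
  ext
  simp [Fin.val_add]

/-- Some choice of `m` signs with product `p` makes `∑ (1 - λ_i w_i)` at most `γ`, unless `γ` is at
least `2` anyway. -/
def SignedCostLE (w : ℕ → ℝ) (m : ℕ) (p γ : ℝ) : Prop :=
  2 ≤ γ ∨ ∃ l : ℕ → ℝ, (∀ i, l i = 1 ∨ l i = -1) ∧ ∏ i ∈ Finset.range m, l i = p ∧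
    ∑ i ∈ Finset.range m, (1 - l i * w i) ≤ γ

theorem SignedCostLE.succ {w : ℕ → ℝ} {m : ℕ} {p γ : ℝ} (h : SignedCostLE w m p γ)
    (hw : |w m| ≤ 1) {s : ℝ} (hs : s = 1 ∨ s = -1) {q γ' : ℝ} (hq : q = p * s)
    (hγ : γ' = γ + (1 - s * w m)) : SignedCostLE w (m + 1) q γ' := by
  subst hq hγ
  rcases h with h | ⟨l, hl, hp, hc⟩
  · rw [abs_le] at hw
    left
    rcases hs with rfl | rfl <;> linarith
  · refine Or.inr ⟨Function.update l m s, fun i => ?_, ?_, ?_⟩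
    · by_cases hi : i = m
      · subst hi
        simpa using hs
      · simpa [hi] using hl i
    · rw [Finset.prod_range_succ, Function.update_self, ← hp]
      congr 1
      refine Finset.prod_congr rfl fun i hi => ?_
      rw [Function.update_of_ne (Finset.mem_range.1 hi).ne]
    · rw [Finset.sum_range_succ, Function.update_self]
      gcongr
      refine le_of_eq_of_le (Finset.sum_congr rfl fun i hi => ?_) hc
      rw [Function.update_of_ne (Finset.mem_range.1 hi).ne]

theorem abs_le_one_of_isPairMoments {a b e : ℝ} (h : IsPairMoments a b e) : |e| ≤ 1 := by
  have h1 := h.1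
  have h2 := h.2
  have := abs_nonneg (a + b)
  have := abs_nonneg (a - b)
  exact abs_le.2 ⟨by linarith, by linarith⟩

section Cycle

variable {n : ℕ} [NeZero n]

/-- Each minimum produced by the step is a choice of the new sign: +1 preserves the parity of the
pattern, -1 exchanges the roles of α and β. -/
theorem PathReach.bunch_step {a b x y : Fin n → ℝ} (hx : ∀ i, IsPairMoments (a i) (b i) (x i))
    {m : ℕ} {α β D : ℝ} (hr : PathReach (interleave a b) (interleave x y) (2 * m) α β)
    (hα : SignedCostLE (fun i => x (Fin.ofNat n i)) m 1 (α - D))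
    (hβ : SignedCostLE (fun i => x (Fin.ofNat n i)) m (-1) (β - D)) :
    ∃ α' β', PathReach (interleave a b) (interleave x y) (2 * m + 1) α' β' ∧
      SignedCostLE (fun i => x (Fin.ofNat n i)) (m + 1) 1 (α' - D) ∧
      SignedCostLE (fun i => x (Fin.ofNat n i)) (m + 1) (-1) (β' - D) := by
  have hw := abs_le_one_of_isPairMoments (hx (Fin.ofNat n m))
  have h := hr.succ (by
    rw [interleave_even, interleave_odd, interleave_even]
    exact hx _)
  rw [interleave_even] at h
  refine ⟨_, _, h, ?_, ?_⟩
  · rcases min_choice (α + (1 - x (Fin.ofNat n m))) (β + (1 + x (Fin.ofNat n m))) with h1 | h1 <;>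
      rw [h1]
    · exact hα.succ hw (Or.inl rfl) (by ring) (by ring)
    · exact hβ.succ hw (Or.inr rfl) (by ring) (by ring)
  · rcases min_choice (α + (1 + x (Fin.ofNat n m))) (β + (1 - x (Fin.ofNat n m))) with h1 | h1 <;>
      rw [h1]
    · exact hα.succ hw (Or.inr rfl) (by ring) (by ring)
    · exact hβ.succ hw (Or.inl rfl) (by ring) (by ring)

theorem exists_pathReach {a b x : Fin n → ℝ} (ha : ∀ i, |a i| ≤ 1) (hb : ∀ i, |b i| ≤ 1)
    (hx : ∀ i, IsPairMoments (a i) (b i) (x i)) (m : ℕ) :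
    ∃ α β, PathReach (interleave a b) (interleave x fun i => 1 - |b i - a (i + 1)|) (2 * m) α β ∧
      SignedCostLE (fun i => x (Fin.ofNat n i)) m 1
        (α - ∑ i ∈ Finset.range m, |b (Fin.ofNat n i) - a (Fin.ofNat n (i + 1))|) ∧
      SignedCostLE (fun i => x (Fin.ofNat n i)) m (-1)
        (β - ∑ i ∈ Finset.range m, |b (Fin.ofNat n i) - a (Fin.ofNat n (i + 1))|) := by
  induction m with
  | zero =>
    -- The empty pattern has product 1 and cost 0. No empty pattern has product -1, which is why the
    -- alternative 2 ≤ γ is needed.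
    refine ⟨0, 2, pathReach_zero _ _ ?_, Or.inr ⟨fun _ => 1, by simp, by simp, by simp⟩,
      Or.inl (by simp)⟩
    exact (interleave_even a b 0) ▸ ha _
  | succ m ih =>
    obtain ⟨α, β, hr, hα, hβ⟩ := ih
    obtain ⟨α', β', hr', hα', hβ'⟩ := hr.bunch_step hx hα hβ
    have h := hr'.succ_max (by rw [interleave_odd]; exact hb _)
      (by rw [show 2 * m + 1 + 1 = 2 * (m + 1) by ring, interleave_even]; exact ha _)
      (by rw [interleave_odd, interleave_odd, show 2 * m + 1 + 1 = 2 * (m + 1) by ring,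
        interleave_even, ofNat_add_one])
    rw [interleave_odd, show 2 * m + 1 + 1 = 2 * (m + 1) by ring, interleave_even] at h
    refine ⟨_, _, h, ?_, ?_⟩
    · rw [Finset.sum_range_succ, add_sub_add_right_eq_sub]
      exact hα'
    · rw [Finset.sum_range_succ, add_sub_add_right_eq_sub]
      exact hβ'

theorem sum_range_ofNat (f : Fin n → ℝ) : ∑ i ∈ Finset.range n, f (Fin.ofNat n i) = ∑ i, f i := by
  rw [← Fin.sum_univ_eq_sum_range fun i => f (Fin.ofNat n i)]
  exact Finset.sum_congr rfl fun i _ => by simp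

theorem sum_abs_sub_pred {m : ℕ} (hm : n = m + 1) (a b : Fin n → ℝ) :
    ∑ i, |a i - b (i - 1)| =
      |a (Fin.ofNat n 0) - b (Fin.ofNat n m)| +
        ∑ i ∈ Finset.range m, |b (Fin.ofNat n i) - a (Fin.ofNat n (i + 1))| := by
  have hr : Finset.range n = Finset.range (m + 1) := by rw [hm]
  rw [← sum_range_ofNat, hr, Finset.sum_range_succ', add_comm]
  congr 1
  · congr 3
    rw [sub_eq_iff_eq_add, ofNat_add_one, ← hm]
    ext
    simp
  · refine Finset.sum_congr rfl fun i _ => ?_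
    rw [← ofNat_add_one, add_sub_cancel_right, abs_sub_comm]

/-- If no odd sign combination of the bunch product expectations is too large, then the cyclic
system has a coupling in which the connections are maximally coupled. -/
theorem exists_cycle_coupling {a b x : Fin n → ℝ} (ha : ∀ i, |a i| ≤ 1) (hb : ∀ i, |b i| ≤ 1)
    (hx : ∀ i, IsPairMoments (a i) (b i) (x i))
    (hl : ∀ l : Fin n → ℝ, (∀ i, l i = 1 ∨ l i = -1) → ∏ i, l i = -1 →
      ∑ i, l i * x i ≤ n - 2 + ∑ i, |a i - b (i - 1)|) :
    ∃ (Ω : Type) (_ : Fintype Ω) (h : Ω → ℝ) (U V : Fin n → Ω → Bool), (∀ ω, 0 ≤ h ω) ∧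
      ∑ ω, h ω = 1 ∧ (∀ i, ∑ ω, h ω * boolSign (U i ω) = a i) ∧
      (∀ i, ∑ ω, h ω * boolSign (V i ω) = b i) ∧
      (∀ i, ∑ ω, h ω * (boolSign (U i ω) * boolSign (V i ω)) = x i) ∧
      ∀ i, ∑ ω, h ω * (boolSign (U i ω) * boolSign (V (i - 1) ω)) = 1 - |a i - b (i - 1)| := by
  obtain ⟨m, hm⟩ : ∃ m, n = m + 1 := Nat.exists_eq_succ_of_ne_zero (NeZero.ne n)
  obtain ⟨α, β, hr, hα, hβ⟩ := exists_pathReach ha hb hx m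
  obtain ⟨α', β', hr', -, hβ'⟩ := hr.bunch_step hx hα hβ
  have hn := sum_abs_sub_pred hm a b
  have hs := hr'.sub_bound
  have h0 : interleave a b 0 = a (Fin.ofNat n 0) := interleave_even a b 0
  rw [h0, interleave_odd] at hs
  -- An odd pattern costs at least n - (n - 2 + δ) = 2 - δ. Adding the path connections, which are δ
  -- without its closing term, leaves 2 minus that term.
  have hβ2 : 2 - |a (Fin.ofNat n 0) - b (Fin.ofNat n m)| ≤ β' := by
    have hD : 0 ≤ ∑ i ∈ Finset.range m, |b (Fin.ofNat n i) - a (Fin.ofNat n (i + 1))| :=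
      Finset.sum_nonneg fun i _ => abs_nonneg _
    have hd := abs_nonneg (a (Fin.ofNat n 0) - b (Fin.ofNat n m))
    rcases hβ' with h | ⟨l, l1, lp, lc⟩
    · linarith
    · have h1 := hl (fun i => l i) (fun i => l1 i) (by
        rw [Fin.prod_univ_eq_prod_range l n, hm, lp])
      have h2 : ∑ i : Fin n, (1 - l i * x i) =
          ∑ i ∈ Finset.range (m + 1), (1 - l i * x (Fin.ofNat n i)) := by
        rw [← hm, ← Fin.sum_univ_eq_sum_range fun i => 1 - l i * x (Fin.ofNat n i)]
        simp
      rw [Finset.sum_sub_distrib] at h2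
      simp only [Finset.sum_const, Finset.card_univ, Fintype.card_fin, nsmul_eq_mul, mul_one] at h2
      linarith
  obtain ⟨Ω, hΩ, h, W, w0, w1, wc, we, wy⟩ := hr'.couples
    (1 - |a (Fin.ofNat n 0) - b (Fin.ofNat n m)|)
    (by rw [h0, interleave_odd]; exact isPairMoments_max (ha _) (hb _)) (by linarith) (by linarith)
  refine ⟨Ω, hΩ, h, fun i => W (2 * i), fun i => W (2 * i + 1), w0, w1, ?_, ?_, ?_, ?_⟩
  · intro i
    rw [wc _ (by omega), interleave_even]
    simp
  · intro i
    rw [wc _ (by omega), interleave_odd]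
    simp
  · intro i
    rw [we _ (by omega), interleave_even]
    simp
  · intro i
    obtain ⟨i, hi⟩ := i
    cases i with
    -- The connection at index 0 is the one that closes the cycle; all others are odd-numbered steps
    -- of the path, traversed in the opposite direction.
    | zero =>
      have e1 : (⟨0, hi⟩ : Fin n) = Fin.ofNat n 0 := by
        ext
        simp
      have e2 : (⟨0, hi⟩ : Fin n) - 1 = Fin.ofNat n m := by
        rw [sub_eq_iff_eq_add, ofNat_add_one, ← hm]
        ext
        simp
      have e3 : m % n = m := Nat.mod_eq_of_lt (by omega)
      rw [e2, e1]
      simpa [e3] using wy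
    | succ k =>
      have e1 : (⟨k + 1, hi⟩ : Fin n) = Fin.ofNat n (k + 1) := by
        ext
        simp [Nat.mod_eq_of_lt hi]
      have e2 : (⟨k + 1, hi⟩ : Fin n) - 1 = Fin.ofNat n k := by
        rw [sub_eq_iff_eq_add, ofNat_add_one, e1]
      have e3 : ((Fin.ofNat n k : Fin n) : ℕ) = k := by
        simp [Nat.mod_eq_of_lt (show k < n by omega)]
      have := we (2 * k + 1) (by omega)
      rw [interleave_odd, ofNat_add_one] at this
      dsimp only
      rw [e2, e3, e1, abs_sub_comm, ← this]
      refine Finset.sum_congr rfl fun ω _ => ?_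
      rw [mul_comm (boolSign _)]
      rfl

end Cycle

/-! ### Expectations, parity and the noncontextuality criterion -/

theorem prob_true_eq {Ω : Type*} [Fintype Ω] {h : Ω → ℝ} (h1 : ∑ ω, h ω = 1) (X : Ω → Bool) :
    prob h (fun ω => X ω = true) = (1 + ∑ ω, h ω * boolSign (X ω)) / 2 := by
  rw [prob, Finset.sum_filter, ← h1, ← Finset.sum_add_distrib, Finset.sum_div]
  refine Finset.sum_congr rfl fun ω _ => ?_
  cases X ω <;> simp

theorem prob_both_true_eq {Ω : Type*} [Fintype Ω] {h : Ω → ℝ} (h1 : ∑ ω, h ω = 1)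
    (X Y : Ω → Bool) :
    prob h (fun ω => X ω = true ∧ Y ω = true) =
      (1 + ∑ ω, h ω * boolSign (X ω) + ∑ ω, h ω * boolSign (Y ω) +
        ∑ ω, h ω * (boolSign (X ω) * boolSign (Y ω))) / 4 := by
  rw [prob, Finset.sum_filter, ← h1, ← Finset.sum_add_distrib, ← Finset.sum_add_distrib,
    ← Finset.sum_add_distrib, Finset.sum_div]
  refine Finset.sum_congr rfl fun ω _ => ?_
  cases X ω <;> cases Y ω <;> simp
  ring

/-- The image of a finite distribution under a map. -/
theorem exists_pushforward {Ω Ω' : Type*} [Fintype Ω] [Fintype Ω'] [DecidableEq Ω'] (h : Ω → ℝ)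
    (h0 : ∀ ω, 0 ≤ h ω) (Φ : Ω → Ω') :
    ∃ g : Ω' → ℝ, (∀ r, 0 ≤ g r) ∧ ∀ f : Ω' → ℝ, ∑ r, g r * f r = ∑ ω, h ω * f (Φ ω) := by
  refine ⟨fun r => ∑ ω with Φ ω = r, h ω, fun r => Finset.sum_nonneg fun ω _ => h0 ω, fun f => ?_⟩
  rw [← Finset.sum_fiberwise Finset.univ Φ fun ω => h ω * f (Φ ω)]
  refine Finset.sum_congr rfl fun r _ => ?_
  rw [Finset.sum_mul]
  refine Finset.sum_congr rfl fun ω hω => ?_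
  rw [(Finset.mem_filter.1 hω).2]

theorem sum_le_card_sub_two {ι : Type*} [Fintype ι] {f : ι → ℝ} (hf : ∀ i, f i = 1 ∨ f i = -1)
    (hp : ∏ i, f i ≠ 1) : ∑ i, f i ≤ Fintype.card ι - 2 := by
  classical
  obtain ⟨i, hi⟩ : ∃ i, f i = -1 := by
    by_contra! h
    exact hp (Finset.prod_eq_one fun i _ => (hf i).resolve_right (h i))
  have h1 : ∑ j, (1 - f j) ≥ 1 - f i := Finset.single_le_sum
    (f := fun j => 1 - f j)
    (fun j _ => by rcases hf j with h | h <;> rw [h] <;> norm_num) (Finset.mem_univ i)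
  rw [Finset.sum_sub_distrib, hi] at h1
  simp only [Finset.sum_const, Finset.card_univ, nsmul_eq_mul, mul_one] at h1
  linarith

theorem sum_mul_le_of_forall_le {Ω : Type*} [Fintype Ω] {h : Ω → ℝ} (h0 : ∀ ω, 0 ≤ h ω)
    (h1 : ∑ ω, h ω = 1) {f : Ω → ℝ} {C : ℝ} (hf : ∀ ω, f ω ≤ C) : ∑ ω, h ω * f ω ≤ C := by
  calc ∑ ω, h ω * f ω ≤ ∑ ω, h ω * C :=
        Finset.sum_le_sum fun ω _ => mul_le_mul_of_nonneg_left (hf ω) (h0 ω)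
    _ = C := by rw [← Finset.sum_mul, h1, one_mul]

theorem one_sub_abs_sub (a b : ℝ) : 1 - |a - b| = 1 - a - b + 2 * min a b := by
  rcases le_total a b with h | h
  · rw [min_eq_left h, abs_of_nonpos (by linarith)]
    ring
  · rw [min_eq_right h, abs_of_nonneg (by linarith)]
    ring

theorem half_min (a b : ℝ) : min ((1 + a) / 2) ((1 + b) / 2) = (1 + min a b) / 2 := by
  rcases le_total a b with h | h
  · rw [min_eq_left h, min_eq_left (by linarith)]
  · rw [min_eq_right h, min_eq_right (by linarith)]

/-- Every u and v occurs in exactly two of the 2n factors, so their product is ∏ λ_i = -1 and at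
least one factor is -1. -/
theorem sum_signs_le {n : ℕ} [NeZero n] {l : Fin n → ℝ} (hl : ∀ i, l i = 1 ∨ l i = -1)
    (hp : ∏ i, l i = -1) (u v : Fin n → Bool) :
    ∑ i, l i * (boolSign (u i) * boolSign (v i)) + ∑ i, boolSign (u i) * boolSign (v (i - 1)) ≤
      2 * n - 2 := by
  have h := sum_le_card_sub_two (ι := Fin n ⊕ Fin n)
    (f := Sum.elim (fun i => l i * (boolSign (u i) * boolSign (v i)))
      fun i => boolSign (u i) * boolSign (v (i - 1))) ?_ ?_
  · simpa [Fintype.sum_sum_type, two_mul] using h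
  · rintro (i | i)
    · rcases hl i with h | h <;> rcases boolSign_eq (u i) with h' | h' <;>
        rcases boolSign_eq (v i) with h'' | h'' <;> simp [h, h', h'']
    · rcases boolSign_eq (u i) with h' | h' <;>
        rcases boolSign_eq (v (i - 1)) with h'' | h'' <;> simp [h', h'']
  · have hv : ∏ i, boolSign (v (i - 1)) = ∏ i, boolSign (v i) :=
      (Equiv.subRight (1 : Fin n)).prod_comp fun i => boolSign (v i)
    have hsq : ∀ w : Fin n → Bool, (∏ i, boolSign (w i)) * ∏ i, boolSign (w i) = 1 := by
      intro w
      rw [← Finset.prod_mul_distrib]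
      exact Finset.prod_eq_one fun i _ => boolSign_mul_self _
    simp only [Fintype.prod_sum_type, Sum.elim_inl, Sum.elim_inr, Finset.prod_mul_distrib, hp, hv]
    rw [show ∀ p q : ℝ, -1 * (p * q) * (p * q) = -((p * p) * (q * q)) by intros; ring, hsq, hsq]
    norm_num

namespace CyclicSystem

variable {n : ℕ}

theorem bunch_nonneg (R : CyclicSystem n) (i : Fin n) (r : Bool × Bool) : 0 ≤ R.bunch i r :=
  (R.bunch_mem i).1 r

theorem sum_bunch (R : CyclicSystem n) (i : Fin n) : ∑ r, R.bunch i r = 1 := (R.bunch_mem i).2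

theorem eOwn_eq (R : CyclicSystem n) (i : Fin n) :
    R.eOwn i = ∑ r, R.bunch i r * boolSign r.1 := by
  rw [eOwn, pOwn, prob_true_eq (R.sum_bunch i)]
  ring

theorem eNext_eq (R : CyclicSystem n) (i : Fin n) :
    R.eNext i = ∑ r, R.bunch i r * boolSign r.2 := by
  rw [eNext, pNext, prob_true_eq (R.sum_bunch i)]
  ring

theorem eBunch_eq (R : CyclicSystem n) (i : Fin n) :
    R.eBunch i = ∑ r, R.bunch i r * (boolSign r.1 * boolSign r.2) := by
  rw [eBunch, pOwn, pNext, pBoth, prob_true_eq (R.sum_bunch i), prob_true_eq (R.sum_bunch i),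
    prob_both_true_eq (R.sum_bunch i)]
  ring

theorem isPairMoments (R : CyclicSystem n) (i : Fin n) :
    IsPairMoments (R.eOwn i) (R.eNext i) (R.eBunch i) := by
  have h1 := R.sum_bunch i
  have h2 := R.bunch_nonneg i
  rw [isPairMoments_iff, R.eOwn_eq, R.eNext_eq, R.eBunch_eq, ← h1]
  simp only [Fintype.sum_prod_type, Fintype.sum_bool, boolSign_true, boolSign_false]
  have := h2 (true, true)
  have := h2 (true, false)
  have := h2 (false, true)
  have := h2 (false, false)
  refine ⟨?_, ?_, ?_, ?_⟩ <;> linarith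

theorem exists_of_isPairMoments {a b x : Fin n → ℝ} (h : ∀ i, IsPairMoments (a i) (b i) (x i)) :
    ∃ R : CyclicSystem n, R.eOwn = a ∧ R.eNext = b ∧ R.eBunch = x := by
  refine ⟨⟨fun i r => (1 + boolSign r.1 * a i + boolSign r.2 * b i +
    boolSign r.1 * boolSign r.2 * x i) / 4, fun i => ⟨?_, ?_⟩⟩, ?_, ?_, ?_⟩
  · obtain ⟨h1, h2, h3, h4⟩ := (isPairMoments_iff _ _ _).1 (h i)
    rintro ⟨s, t⟩
    cases s <;> cases t <;> simp <;> linarith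
  · simp [Fintype.sum_prod_type]
    ring
  · ext i
    rw [eOwn_eq]
    simp [Fintype.sum_prod_type]
    ring
  · ext i
    rw [eNext_eq]
    simp [Fintype.sum_prod_type]
    ring
  · ext i
    rw [eBunch_eq]
    simp [Fintype.sum_prod_type]
    ring

theorem pOwn_eq (R : CyclicSystem n) (i : Fin n) : R.pOwn i = (1 + R.eOwn i) / 2 := by
  rw [eOwn]
  ring

theorem pNext_eq (R : CyclicSystem n) (i : Fin n) : R.pNext i = (1 + R.eNext i) / 2 := by
  rw [eNext]
  ring

theorem pBoth_eq (R : CyclicSystem n) (i : Fin n) :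
    R.pBoth i = (1 + R.eOwn i + R.eNext i + R.eBunch i) / 4 := by
  rw [eOwn, eNext, eBunch]
  ring

/-- A maximally connected coupling, described by expectations. -/
theorem isCoupling_and_max_iff [NeZero n] (R : CyclicSystem n) (h : (Fin n → Bool × Bool) → ℝ) :
    (R.IsCoupling h ∧ ∀ i, prob h (fun r => (r i).1 = true ∧ (r (i - 1)).2 = true) =
      min (R.pOwn i) (R.pNext (i - 1))) ↔
    ((∀ r, 0 ≤ h r) ∧ ∑ r, h r = 1) ∧
      (∀ i, ∑ r, h r * boolSign (r i).1 = R.eOwn i) ∧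
      (∀ i, ∑ r, h r * boolSign (r i).2 = R.eNext i) ∧
      (∀ i, ∑ r, h r * (boolSign (r i).1 * boolSign (r i).2) = R.eBunch i) ∧
      ∀ i, ∑ r, h r * (boolSign (r i).1 * boolSign (r (i - 1)).2) =
        1 - |R.eOwn i - R.eNext (i - 1)| := by
  rw [IsCoupling]
  change ((((∀ r, 0 ≤ h r) ∧ ∑ r, h r = 1) ∧ _) ∧ _) ↔ _
  rw [and_assoc]
  refine and_congr_right fun ⟨_, h1⟩ => ?_
  simp only [fun i => prob_true_eq h1 fun r : Fin n → Bool × Bool => (r i).1,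
    fun i => prob_true_eq h1 fun r : Fin n → Bool × Bool => (r i).2,
    fun i j => prob_both_true_eq h1 (fun r : Fin n → Bool × Bool => (r i).1) fun r => (r j).2,
    pOwn_eq, pNext_eq, pBoth_eq, half_min, one_sub_abs_sub]
  constructor
  · rintro ⟨hc, hm⟩
    have ho : ∀ i, ∑ r, h r * boolSign (r i).1 = R.eOwn i := fun i => by linarith [(hc i).1]
    have hn : ∀ i, ∑ r, h r * boolSign (r i).2 = R.eNext i := fun i => by linarith [(hc i).2.1]
    refine ⟨ho, hn, fun i => ?_, fun i => ?_⟩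
    · linarith [(hc i).2.2, ho i, hn i]
    · linarith [hm i, ho i, hn (i - 1)]
  · rintro ⟨ho, hn, hb, hm⟩
    refine ⟨fun i => ⟨?_, ?_, ?_⟩, fun i => ?_⟩
    · rw [ho]
    · rw [hn]
    · rw [ho, hn, hb]
    · rw [ho, hn, hm]
      ring

theorem abs_eOwn_le (R : CyclicSystem n) (i : Fin n) : |R.eOwn i| ≤ 1 := by
  obtain ⟨h1, h2, h3, h4⟩ := (isPairMoments_iff _ _ _).1 (R.isPairMoments i)
  exact abs_le.2 ⟨by linarith, by linarith⟩

theorem abs_eNext_le (R : CyclicSystem n) (i : Fin n) : |R.eNext i| ≤ 1 := by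
  obtain ⟨h1, h2, h3, h4⟩ := (isPairMoments_iff _ _ _).1 (R.isPairMoments i)
  exact abs_le.2 ⟨by linarith, by linarith⟩

/-- The criterion of noncontextuality of a cyclic system. -/
theorem isNoncontextual_iff [NeZero n] (R : CyclicSystem n) :
    R.IsNoncontextual ↔ ∀ l : Fin n → ℝ, (∀ i, l i = 1 ∨ l i = -1) → ∏ i, l i = -1 →
      ∑ i, l i * R.eBunch i ≤ n - 2 + ∑ i, |R.eOwn i - R.eNext (i - 1)| := by
  simp only [IsNoncontextual, isCoupling_and_max_iff]
  constructor
  · rintro ⟨h, ⟨h0, h1⟩, -, -, hb, hm⟩ l hl hp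
    have key := sum_mul_le_of_forall_le h0 h1 fun r =>
      sum_signs_le hl hp (fun i => (r i).1) fun i => (r i).2
    have e1 : ∑ r, h r * ∑ i, l i * (boolSign (r i).1 * boolSign (r i).2) =
        ∑ i, l i * R.eBunch i := by
      simp only [Finset.mul_sum, ← hb]
      rw [Finset.sum_comm]
      exact Finset.sum_congr rfl fun i _ => Finset.sum_congr rfl fun r _ => by ring
    have e2 : ∑ r, h r * ∑ i, boolSign (r i).1 * boolSign (r (i - 1)).2 =
        ∑ i, (1 - |R.eOwn i - R.eNext (i - 1)|) := by
      simp only [Finset.mul_sum, ← hm]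
      rw [Finset.sum_comm]
    simp only [mul_add, Finset.sum_add_distrib] at key
    rw [e1, e2, Finset.sum_sub_distrib] at key
    simp only [Finset.sum_const, Finset.card_univ, Fintype.card_fin, nsmul_eq_mul, mul_one] at key
    linarith
  · intro hl
    obtain ⟨Ω, _, h, U, V, h0, h1, hU, hV, hb, hm⟩ :=
      exists_cycle_coupling R.abs_eOwn_le R.abs_eNext_le R.isPairMoments hl
    obtain ⟨g, g0, hg⟩ := exists_pushforward h h0 fun ω i => (U i ω, V i ω)
    refine ⟨g, ⟨g0, ?_⟩, fun i => ?_, fun i => ?_, fun i => ?_, fun i => ?_⟩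
    · simpa [h1] using hg fun _ => 1
    · rw [hg, ← hU]
    · rw [hg, ← hV]
    · rw [hg, ← hb]
    · rw [hg, ← hm]

end CyclicSystem

/-! ### Edges, regularity and the number of odd vertices -/

theorem vertexSign_eq {n : ℕ} (lo V : Fin n → ℝ) (i : Fin n) :
    vertexSign lo V i = 1 ∨ vertexSign lo V i = -1 := by
  unfold vertexSign
  split_ifs <;> simp

theorem prod_vertexSign {n : ℕ} (lo V : Fin n → ℝ) :
    ∏ i, vertexSign lo V i = (-1) ^ {i | V i = lo i}.ncard := by
  classical
  rw [Set.ncard_eq_toFinset_card']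
  simp [vertexSign, Finset.prod_ite]

theorem odd_iff_prod_vertexSign {n : ℕ} (lo V : Fin n → ℝ) :
    Odd {i | V i = lo i}.ncard ↔ ∏ i, vertexSign lo V i = -1 := by
  rw [prod_vertexSign, neg_one_pow_eq_neg_one_iff_odd (by norm_num)]

theorem mem_boxEdge_iff {n : ℕ} {lo hi V : Fin n → ℝ} {i : Fin n}
    (hV : V i = lo i ∨ V i = hi i) (y : Fin n → ℝ) :
    y ∈ boxEdge lo hi V i ↔ ∃ s ∈ Set.Icc (0 : ℝ) 1,
      y = Function.update V i (V i - vertexSign lo V i * (s * (hi i - lo i))) := by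
  have key : ∀ s : ℝ, V + s • (Function.update V i (lo i + hi i - V i) - V) =
      Function.update V i (V i - vertexSign lo V i * (s * (hi i - lo i))) := by
    intro s
    ext j
    by_cases hj : j = i
    · subst hj
      simp only [Pi.add_apply, Pi.smul_apply, Pi.sub_apply, Function.update_self, smul_eq_mul,
        vertexSign]
      split_ifs with h
      · rw [h]
        ring
      · rw [hV.resolve_left h]
        ring
    · simp [hj]
  rw [boxEdge, segment_eq_image']
  simp only [Set.mem_image, key, eq_comm]

theorem sum_mul_update {n : ℕ} {l : Fin n → ℝ} (hl : ∀ i, l i = 1 ∨ l i = -1) (V : Fin n → ℝ)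
    (i : Fin n) (t : ℝ) :
    ∑ j, l j * Function.update V i (V i - l i * t) j = ∑ j, l j * V j - t := by
  have hll : l i * l i = 1 := by rcases hl i with h | h <;> rw [h] <;> norm_num
  rw [sub_eq_add_neg, ← Finset.add_sum_erase _ _ (Finset.mem_univ i),
    ← Finset.add_sum_erase Finset.univ (fun j => l j * V j) (Finset.mem_univ i),
    Function.update_self, Finset.sum_congr rfl fun j hj => by
      rw [Function.update_of_ne (Finset.ne_of_mem_erase hj)]]
  linear_combination -t * hll

theorem dist_update_sub {n : ℕ} {l : ℝ} (hl : l = 1 ∨ l = -1) (V : Fin n → ℝ)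
    (i : Fin n) {t : ℝ} (ht : 0 ≤ t) : dist V (Function.update V i (V i - l * t)) = t := by
  have h : V - Function.update V i (V i - l * t) = Pi.single i (l * t) := by
    ext j
    by_cases hj : j = i
    · subst hj
      simp
    · simp [hj]
  rw [dist_eq_norm, h, Pi.norm_single, Real.norm_eq_abs, abs_mul, abs_of_nonneg ht]
  rcases hl with rfl | rfl <;> simp

/-- A pocket-forming hyperplane orthogonal to the direction of the signs of a vertex forms a regular
pocket. -/
theorem isRegularAt_of_isPocketVertex {n : ℕ} {lo hi V : Fin n → ℝ} {d : ℝ}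
    (hle : ∀ i, lo i ≤ hi i) (h : IsPocketVertex lo hi d V) :
    IsRegularAt lo hi V (hyperplane (vertexSign lo V) d) := by
  refine ⟨h.2, ∑ i, vertexSign lo V i * V i - d, fun i y hy hd => ?_⟩
  obtain ⟨s, hs, rfl⟩ := (mem_boxEdge_iff (h.1.1 i) y).1 hy
  rw [hyperplane, Set.mem_ofPred_eq, sum_mul_update (vertexSign_eq lo V)] at hd
  rw [dist_update_sub (vertexSign_eq lo V i) V i (mul_nonneg hs.1 (sub_nonneg.2 (hle i)))]
  linarith

/-- The cut on each edge lies at distance t, the excess of V over d: t > 0 separates it from V, and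
t at most the edge length keeps it on the edge. -/
theorem isPocketForming_of_le {n : ℕ} {lo hi V : Fin n → ℝ} {d : ℝ} (hlt : ∀ i, lo i < hi i)
    (hV : ∀ i, V i = lo i ∨ V i = hi i) (hpos : d < ∑ i, vertexSign lo V i * V i)
    (hle : ∀ i, ∑ j, vertexSign lo V j * V j - d ≤ hi i - lo i) :
    IsPocketForming lo hi V (hyperplane (vertexSign lo V) d) := by
  intro i
  have hL : 0 < hi i - lo i := sub_pos.2 (hlt i)
  set t := ∑ j, vertexSign lo V j * V j - d with ht
  have ht0 : 0 < t := sub_pos.2 hpos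
  have hdiv : t / (hi i - lo i) * (hi i - lo i) = t := div_mul_cancel₀ _ hL.ne'
  refine ⟨_, (mem_boxEdge_iff (hV i) _).2 ⟨t / (hi i - lo i),
    ⟨div_nonneg ht0.le hL.le, (div_le_one hL).2 (hle i)⟩, rfl⟩, ?_, ?_⟩
  · rw [hyperplane, Set.mem_ofPred_eq, sum_mul_update (vertexSign_eq lo V), hdiv, ht]
    ring
  · intro h
    have := dist_update_sub (vertexSign_eq lo V i) V i ht0.le
    rw [hdiv] at h
    rw [h, dist_self] at this
    exact ht0.ne this

/-- Parity recovers the sign of coordinate 0 from the others, so an odd vertex is determined by the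
min-coordinates among the remaining n - 1. -/
theorem encard_oddVertex_le {n : ℕ} [NeZero n] (lo hi : Fin n → ℝ) :
    {V | IsOddVertex lo hi V}.encard ≤ (2 ^ (n - 1) : ℕ) := by
  classical
  obtain ⟨m, rfl⟩ : ∃ m, n = m + 1 := Nat.exists_eq_succ_of_ne_zero (NeZero.ne n)
  have hcard : (Set.univ : Set (Finset (Fin m))).encard = (2 ^ (m + 1 - 1) : ℕ) := by
    rw [Set.encard_univ, ENat.card_eq_coe_fintype_card]
    simp
  rw [← hcard]
  refine Set.encard_le_encard_of_injOn
    (f := fun V => Finset.univ.filter fun i : Fin m => V i.succ = lo i.succ)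
    (fun _ _ => Set.mem_univ _) ?_
  rintro V ⟨hV, hVo⟩ W ⟨hW, hWo⟩ hVW
  have hs : ∀ i : Fin m, V i.succ = lo i.succ ↔ W i.succ = lo i.succ := by
    intro i
    simpa using Finset.ext_iff.1 hVW i
  have hsign : ∀ i : Fin m, vertexSign lo V i.succ = vertexSign lo W i.succ := fun i => by
    simp only [vertexSign, hs]
  have h0 : vertexSign lo V 0 = vertexSign lo W 0 := by
    rw [odd_iff_prod_vertexSign, Fin.prod_univ_succ] at hVo hWo
    simp only [hsign] at hVo
    exact mul_right_cancel₀ (b := ∏ i : Fin m, vertexSign lo W i.succ)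
      (fun h => by rw [h] at hWo; norm_num at hWo) (hVo.trans hWo.symm)
  have hall : ∀ i, vertexSign lo V i = vertexSign lo W i := Fin.cases h0 hsign
  ext i
  have := hall i
  unfold vertexSign at this
  split_ifs at this with h1 h2 h2
  · rw [h1, h2]
  · norm_num at this
  · norm_num at this
  · rw [(hV i).resolve_left h1, (hW i).resolve_left h2]

theorem encard_pockets_le {n : ℕ} [NeZero n] (lo hi : Fin n → ℝ) (d : ℝ) :
    (pockets lo hi d).encard ≤ (2 ^ (n - 1) : ℕ) := by
  have h : pockets lo hi d ⊆ (fun V => pocket lo hi (vertexSign lo V) d) ''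
      {V | IsOddVertex lo hi V} := by
    rintro P ⟨V, hV, rfl⟩
    exact ⟨V, hV.1, rfl⟩
  exact (Set.encard_le_encard h).trans ((Set.encard_image_le _ _).trans (encard_oddVertex_le lo hi))

/-! ### Triangle inequality around the cycle -/

/-- Signs around a cycle with product `1` are the quotients of consecutive signs. -/
theorem exists_sign_potential {n : ℕ} [NeZero n] {l : Fin n → ℝ} (hl : ∀ i, l i = 1 ∨ l i = -1)
    (hp : ∏ i, l i = 1) :
    ∃ ε : Fin n → ℝ, (∀ i, |ε i| = 1) ∧ ∀ i, ε (i + 1) = ε i * l i := by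
  obtain ⟨m, rfl⟩ : ∃ m, n = m + 1 := Nat.exists_eq_succ_of_ne_zero (NeZero.ne n)
  refine ⟨fun i => ∏ k ∈ Finset.Iio i, l k, fun i => ?_, fun i => ?_⟩
  · rw [Finset.abs_prod]
    exact Finset.prod_eq_one fun k _ => by rcases hl k with h | h <;> rw [h] <;> simp
  · have hins : ∀ i : Fin (m + 1), (∏ k ∈ Finset.Iio i, l k) * l i = ∏ k ∈ Finset.Iic i, l k := by
      intro i
      rw [← Finset.Iio_insert, Finset.prod_insert (by simp), mul_comm]
    rw [hins]
    rcases eq_or_ne i (Fin.last m) with rfl | hi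
    · rw [Fin.last_add_one, show Finset.Iic (Fin.last m) = Finset.univ from by
        ext
        simp [Fin.le_last], hp]
      exact Finset.prod_eq_one fun k hk => absurd (Finset.mem_Iio.1 hk) (Fin.not_lt_zero k)
    · refine Finset.prod_congr ?_ fun _ _ => rfl
      ext k
      have : i < Fin.last m := lt_of_le_of_ne (Fin.le_last i) hi
      simp only [Finset.mem_Iio, Finset.mem_Iic, Fin.lt_def, Fin.le_def,
        Fin.val_add_one_of_lt this]
      omega

/-- Multiplication by the potential ε turns the differences into steps of a closed walk, as ε_j λ_j
b_j = ε_{j+1} b_j. One step of a closed walk is at most the sum of the others. -/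
theorem two_mul_abs_sub_le_of_even {n : ℕ} [NeZero n] {l : Fin n → ℝ}
    (hl : ∀ i, l i = 1 ∨ l i = -1) (hp : ∏ i, l i = 1) (a b : Fin n → ℝ) (i : Fin n) :
    2 * |a i - l i * b i| ≤ ∑ j, |a j - l j * b j| + ∑ j, |a j - b (j - 1)| := by
  obtain ⟨ε, hε, hs⟩ := exists_sign_potential hl hp
  have hsum : ∑ j, ε j * (a j - l j * b j) = ∑ j, ε j * (a j - b (j - 1)) := by
    have h := (Equiv.subRight (1 : Fin n)).sum_comp fun j => ε (j + 1) * b j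
    simp only [Equiv.subRight_apply, sub_add_cancel] at h
    simp only [mul_sub, Finset.sum_sub_distrib]
    rw [h]
    simp only [hs, mul_assoc]
  rw [← Finset.add_sum_erase _ _ (Finset.mem_univ i)] at hsum
  rw [← Finset.add_sum_erase Finset.univ (fun j => |a j - l j * b j|) (Finset.mem_univ i)]
  have habs : ∀ j t, |ε j * t| = |t| := fun j t => by rw [abs_mul, hε, one_mul]
  have h1 : |ε i * (a i - l i * b i)| ≤ |∑ j, ε j * (a j - b (j - 1))| +
      |∑ j ∈ Finset.univ.erase i, ε j * (a j - l j * b j)| := by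
    rw [← hsum]
    exact le_of_eq_of_le (by rw [add_sub_cancel_right]) (abs_sub _ _)
  have h2 := Finset.abs_sum_le_sum_abs (fun j => ε j * (a j - b (j - 1))) Finset.univ
  have h3 := Finset.abs_sum_le_sum_abs (fun j => ε j * (a j - l j * b j)) (Finset.univ.erase i)
  simp only [habs] at h1 h2 h3
  linarith

/-- Flipping λ_i makes the pattern even; one copy of |a_i + λ_i b_i| then cancels from both sides of
the even inequality. -/
theorem abs_add_abs_le_of_odd {n : ℕ} [NeZero n] {l : Fin n → ℝ}
    (hl : ∀ i, l i = 1 ∨ l i = -1) (hp : ∏ i, l i = -1) (a b : Fin n → ℝ) (i : Fin n) :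
    |a i + l i * b i| + |a i - l i * b i| ≤
      ∑ j, |a j - l j * b j| + ∑ j, |a j - b (j - 1)| := by
  have h := two_mul_abs_sub_le_of_even (l := Function.update l i (-l i)) (fun j => ?_) ?_ a b i
  · rw [← Finset.add_sum_erase _ _ (Finset.mem_univ i), Function.update_self,
      Finset.sum_congr rfl fun j hj => by
        rw [Function.update_of_ne (Finset.ne_of_mem_erase hj)]] at h
    rw [← Finset.add_sum_erase Finset.univ (fun j => |a j - l j * b j|) (Finset.mem_univ i)]
    rw [neg_mul, sub_neg_eq_add] at h
    linarith
  · by_cases hj : j = i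
    · subst hj
      rcases hl j with h | h <;> simp [h]
    · simpa [hj] using hl j
  · rw [← Finset.mul_prod_erase _ _ (Finset.mem_univ i), Function.update_self,
      Finset.prod_congr rfl fun j hj => by
        rw [Function.update_of_ne (Finset.ne_of_mem_erase hj)], neg_mul,
      Finset.mul_prod_erase _ _ (Finset.mem_univ i), hp, neg_neg]

/-! ### From violated inequalities to pockets -/

theorem boxMin_lt_boxMax {n : ℕ} {a b : Fin n → ℝ} (ha : ∀ i, |a i| < 1) (hb : ∀ i, |b i| < 1)
    (i : Fin n) : boxMin a b i < boxMax a b i := by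
  have h1 := abs_lt.1 (ha i)
  have h2 := abs_lt.1 (hb i)
  unfold boxMin boxMax
  rcases abs_choice (a i + b i) with h3 | h3 <;> rcases abs_choice (a i - b i) with h4 | h4 <;>
    rw [h3, h4] <;> linarith

theorem isPairMoments_iff_mem_box {n : ℕ} (a b x : Fin n → ℝ) :
    (∀ i, IsPairMoments (a i) (b i) (x i)) ↔ x ∈ Set.Icc (boxMin a b) (boxMax a b) := by
  simp only [IsPairMoments, Set.mem_Icc, Pi.le_def, boxMin, boxMax, forall_and]

/-- A point represents a contextual system if and only if it is in the box and violates one of the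
inequalities that characterize noncontextual systems. -/
theorem representsContextual_iff {n : ℕ} [NeZero n] (a b x : Fin n → ℝ) :
    RepresentsContextual a b x ↔ x ∈ Set.Icc (boxMin a b) (boxMax a b) ∧
      ∃ l : Fin n → ℝ, (∀ i, l i = 1 ∨ l i = -1) ∧ ∏ i, l i = -1 ∧
        n - 2 + ∑ i, |a i - b (i - 1)| < ∑ i, l i * x i := by
  rw [← isPairMoments_iff_mem_box]
  constructor
  · rintro ⟨R, rfl, rfl, rfl, hR⟩
    rw [R.isNoncontextual_iff] at hR
    push Not at hR
    exact ⟨R.isPairMoments, hR⟩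
  · rintro ⟨hx, l, hl, hp, h⟩
    obtain ⟨R, rfl, rfl, rfl⟩ := CyclicSystem.exists_of_isPairMoments hx
    exact ⟨R, rfl, rfl, rfl, fun hR => (R.isNoncontextual_iff.1 hR l hl hp).not_gt h⟩

theorem mul_le_one_of_sign {l x : ℝ} (hl : l = 1 ∨ l = -1) (hx : |x| ≤ 1) : l * x ≤ 1 := by
  rw [abs_le] at hx
  rcases hl with rfl | rfl <;> linarith

theorem exists_isPocketVertex {n : ℕ} [NeZero n] {a b x l : Fin n → ℝ} (ha : ∀ i, |a i| < 1)
    (hb : ∀ i, |b i| < 1) (hx : x ∈ Set.Icc (boxMin a b) (boxMax a b))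
    (hl : ∀ i, l i = 1 ∨ l i = -1) (hp : ∏ i, l i = -1) (h : Delta a b < ∑ i, l i * x i) :
    ∃ V, IsPocketVertex (boxMin a b) (boxMax a b) (Delta a b) V ∧
      vertexSign (boxMin a b) V = l := by
  have hlt := boxMin_lt_boxMax ha hb
  set V : Fin n → ℝ := fun i => if l i = -1 then boxMin a b i else boxMax a b i with hVdef
  have hV : ∀ i, V i = boxMin a b i ∨ V i = boxMax a b i := fun i => by
    simp only [hVdef]
    split_ifs <;> simp
  have hs : vertexSign (boxMin a b) V = l := by
    ext i
    simp only [vertexSign, hVdef]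
    rcases hl i with h1 | h1
    · norm_num [h1, (hlt i).ne']
    · rw [h1, if_pos rfl, if_pos rfl]
  have hlV : ∀ i, l i * V i = 1 - |a i - l i * b i| := fun i => by
    simp only [hVdef, boxMin, boxMax]
    rcases hl i with h1 | h1
    · rw [h1, if_neg (by norm_num)]
      simp
    · rw [h1, if_pos rfl]
      simp
  have hlen : ∀ i, boxMax a b i - boxMin a b i =
      2 - |a i + l i * b i| - |a i - l i * b i| := fun i => by
    simp only [boxMin, boxMax]
    rcases hl i with h1 | h1
    · rw [h1, one_mul]
      ring
    · rw [h1, neg_one_mul, sub_neg_eq_add, ← sub_eq_add_neg]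
      ring
  have hxV : ∑ i, l i * x i ≤ ∑ i, l i * V i := by
    refine Finset.sum_le_sum fun i _ => ?_
    have h3 := hx.1 i
    have h4 := hx.2 i
    simp only [hVdef]
    rcases hl i with h1 | h1
    · rw [h1, if_neg (by norm_num)]
      linarith
    · rw [h1, if_pos rfl]
      linarith
  have hsumV : ∑ i, l i * V i = n - ∑ i, |a i - l i * b i| := by
    simp [hlV, Finset.sum_sub_distrib]
  refine ⟨V, ⟨⟨hV, ?_⟩, isPocketForming_of_le hlt hV ?_ fun i => ?_⟩, hs⟩
  · rw [odd_iff_prod_vertexSign, hs, hp]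
  · rw [hs]
    exact h.trans_le hxV
  -- The excess n - ∑ |a_j - λ_j b_j| - Δ must be at most the edge length, for either term of the
  -- minimum in Δ. The term n needs only |a_i + λ_i b_i| ≤ 2.
  · rw [hs, hlen, hsumV, sub_le_comm, Delta, le_min_iff]
    constructor
    · linarith [abs_add_abs_le_of_odd hl hp a b i]
    · have h1 := Finset.single_le_sum (f := fun j => |a j - l j * b j|)
        (fun j _ => abs_nonneg _) (Finset.mem_univ i)
      have h2 : |a i + l i * b i| ≤ 2 := by
        have h3 := abs_lt.1 (ha i)
        have h4 := abs_lt.1 (hb i)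
        rw [abs_le]
        rcases hl i with h5 | h5 <;> rw [h5] <;> constructor <;> linarith
      linarith

theorem mainTheorem4 (n : ℕ) [NeZero n] (hn : 2 ≤ n) (a b : Fin n → ℝ)
    (ha : ∀ i, |a i| < 1) (hb : ∀ i, |b i| < 1) :
    (∀ x : Fin n → ℝ, RepresentsContextual a b x ↔
      ∃ P ∈ pockets (boxMin a b) (boxMax a b) (Delta a b), x ∈ P) ∧
    (∀ V : Fin n → ℝ, IsPocketVertex (boxMin a b) (boxMax a b) (Delta a b) V →
      IsRegularAt (boxMin a b) (boxMax a b) V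
        (hyperplane (vertexSign (boxMin a b) V) (Delta a b))) ∧
    ∃ k : ℕ, (pockets (boxMin a b) (boxMax a b) (Delta a b)).encard = k ∧
      0 ≤ k ∧ k ≤ 2 ^ (n - 1) := by
  refine ⟨fun x => ?_, fun V hV =>
    isRegularAt_of_isPocketVertex (fun i => (boxMin_lt_boxMax ha hb i).le) hV, ?_⟩
  · rw [representsContextual_iff]
    constructor
    · rintro ⟨hx, l, hl, hp, h⟩
      have hΔ : Delta a b < ∑ i, l i * x i := (min_le_left _ _).trans_lt h
      obtain ⟨V, hV, rfl⟩ := exists_isPocketVertex ha hb hx hl hp hΔ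
      exact ⟨_, ⟨V, hV, rfl⟩, hx, hΔ⟩
    · rintro ⟨P, ⟨V, hV, rfl⟩, hx, hΔ⟩
      refine ⟨hx, _, vertexSign_eq _ V, (odd_iff_prod_vertexSign _ V).1 hV.1.2, ?_⟩
      -- No point of the box exceeds n, so exceeding Δ means exceeding its first term, n - 2 + δ.
      have hle : ∑ i, vertexSign (boxMin a b) V i * x i ≤ n := by
        refine (Finset.sum_le_sum fun i _ => mul_le_one_of_sign (vertexSign_eq _ V i)
          (abs_le_one_of_isPairMoments ((isPairMoments_iff_mem_box a b x).2 hx i))).trans ?_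
        simp
      exact ((min_lt_iff.1 hΔ).resolve_right hle.not_gt)
  · have hle := encard_pockets_le (boxMin a b) (boxMax a b) (Delta a b)
    obtain ⟨k, hk⟩ := ENat.ne_top_iff_exists.1 (ne_top_of_le_ne_top (ENat.natCast_ne_top _) hle)
    refine ⟨k, hk.symm, Nat.zero_le k, ?_⟩
    rw [← hk] at hle
    exact_mod_cast hle
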